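/- Let $V(z)=a_m\prod_{k=1}^m(z-\zeta_k)\in\mathbb C[z]$ with $m\ge 1$ and $a_m\ne 0$, let $r>0$, and let $L=\{z\in\mathbb C:|V(z)|=r\}$. Let $\mu$ be the measure on $L$ given by $$d\mu(z)=\frac{|V'(z)|}{2\pi m r}\,|dz|,\qquad z\in L,$$ where $|dz|$ denotes arc length (one-dimensional Hausdorff measure) on $L$ (it is well known that $\mu$ is the equilibrium measure of $L$). For a nonzero polynomial $P$ put $M_L(P)=\exp\left(\int\log|P|\,d\mu\right)$. Then $\mu$ is a probability measure, and for every polynomial $P(z)=c_n\prod_{k=1}^n(z-z_k)\in\mathbb C[z]$ with $n\ge 0$ and $c_n\neq 0$, the function $\log|P|$ is $\mu$-integrable and $$M_L(P)=|c_n|\,|a_m|^{-n/m}\left(\prod_{k=1}^n\max(r,|V(z_k)|)\right)^{1/m}.$$ Furthermore, $$M_L(P)\ge |a_m|^{-n/m}\,|\mathrm{Res}(P,V)|^{1/m},$$ where $\mathrm{Res}(P,V)$ is the resultant of $P$ and $V$. -/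

import Mathlib

open MeasureTheory Polynomial

namespace Lemniscate

/-- The lemniscate `L = {z ∈ ℂ : |V(z)| = r}` of a complex polynomial `V`. -/
def lemniscate (V : ℂ[X]) (r : ℝ) : Set ℂ := {z | ‖V.eval z‖ = r}

/-- The measure `dμ(z) = |V'(z)| / (2π m r) |dz|` on the lemniscate `{|V| = r}`, where `m = deg V`.
The arc length `|dz|` on the lemniscate is the one-dimensional Hausdorff measure of the Euclidean
plane, restricted to the lemniscate. -/
noncomputable def equilibriumMeasure (V : ℂ[X]) (r : ℝ) : Measure ℂ :=
  (Measure.restrict (Measure.hausdorffMeasure 1) (lemniscate V r)).withDensity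
    fun z => ENNReal.ofReal (‖V.derivative.eval z‖ / (2 * Real.pi * V.natDegree * r))

/-- The geometric mean `exp (∫ log |P| dμ)` of a polynomial with respect to a measure `μ`. -/
noncomputable def geometricMean (μ : Measure ℂ) (P : ℂ[X]) : ℝ :=
  Real.exp (∫ z, Real.log ‖P.eval z‖ ∂μ)

/-- The generalized Mahler measure `M_L(P)` over the lemniscate `L = {|V| = r}`. -/
noncomputable def mahlerMeasure (V : ℂ[X]) (r : ℝ) (P : ℂ[X]) : ℝ :=
  geometricMean (equilibriumMeasure V r) P

end Lemniscate

/-! The polynomial `V` maps `L` onto the circle `|w| = r`, and away from its critical points it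
stretches arc length by `|V'|`. Hence `|V'| |dz|` is the pullback of arc length, and integrating
against `μ` means averaging over the circle the mean over the `m` roots of `V = w`
(`Lemniscate.lintegral_equilibriumMeasure`). The finitely many critical values are negligible. For
`log |z - a|` the sum over a fiber is `log |w - V(a)| - log |a_m|`, because `V - w` factors over its
roots; Jensen's formula then averages `log |w - V(a)|` to `log max(r, |V(a)|)`. Summing over the
zeros of `P` gives the formula. The lower bound follows from `max(r, |V(z_k)|) ≥ |V(z_k)|` and the
expression of the resultant as `c_n ^ m ∏ V(z_k)`. The change of variables is an area formula for
Hausdorff measure, `lintegral_count_inter_fiber`: the domain is cut into countably many pieces on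
which the map is a similarity up to a factor `K`, and then `K → 1`. -/

open scoped NNReal ENNReal Topology

/-- The multiplicity of a map that is injective on `s`. -/
lemma count_inter_fiber_of_injOn {X Y : Type*} [MeasurableSpace X]
    [MeasurableSingletonClass X] {f : X → Y} {s : Set X} (h : Set.InjOn f s)
    (y : Y) : Measure.count (s ∩ f ⁻¹' {y}) = (f '' s).indicator (1 : Y → ℝ≥0∞) y := by
  by_cases hy : y ∈ f '' s
  · obtain ⟨x, hx, rfl⟩ := hy
    have : s ∩ f ⁻¹' {f x} = {x} := by
      ext z
      exact ⟨fun hz => h hz.1 hx hz.2, by rintro rfl; exact ⟨hx, rfl⟩⟩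
    rw [this, Set.indicator_of_mem (Set.mem_image_of_mem f hx), Measure.count_singleton]
    rfl
  · have : s ∩ f ⁻¹' {y} = ∅ :=
      Set.eq_empty_of_forall_notMem fun z hz => hy ⟨z, hz.1, hz.2⟩
    rw [this, Set.indicator_of_notMem hy, measure_empty]

/-! ### One-dimensional area formula -/

section AreaFormula

variable {X Y : Type*} [MetricSpace X] [MetricSpace Y]

/-- The map `f` distorts distances between points near `x` by a factor that tends to `c`. -/
def HasScalingAt (f : X → Y) (c : ℝ≥0) (x : X) : Prop :=
  ∀ K : ℝ≥0, 1 < K → ∃ U ∈ 𝓝 x, ∀ y ∈ U, ∀ z ∈ U,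
    edist (f y) (f z) ≤ ↑(K * c) * edist y z ∧ edist y z ≤ ↑(K / c) * edist (f y) (f z)

/-- The map `f` distorts distances on `s` by the factor `c`, up to a factor `K`, and `ρ` is within
a factor `K` of `c` on `s`. -/
structure IsAlmostSimilarityOn (f : X → Y) (ρ : X → ℝ≥0) (K c : ℝ≥0) (s : Set X) : Prop where
  ne_zero : c ≠ 0
  le : ∀ y ∈ s, ∀ z ∈ s, edist (f y) (f z) ≤ ↑(K * c) * edist y z
  ge : ∀ y ∈ s, ∀ z ∈ s, edist y z ≤ ↑(K / c) * edist (f y) (f z)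
  density_le : ∀ y ∈ s, ρ y ≤ K * c
  le_density : ∀ y ∈ s, c ≤ K * ρ y

namespace IsAlmostSimilarityOn

variable {f : X → Y} {ρ : X → ℝ≥0} {K c : ℝ≥0} {s t : Set X}

lemma mono (h : IsAlmostSimilarityOn f ρ K c s) (hts : t ⊆ s) :
    IsAlmostSimilarityOn f ρ K c t where
  ne_zero := h.ne_zero
  le y hy z hz := h.le y (hts hy) z (hts hz)
  ge y hy z hz := h.ge y (hts hy) z (hts hz)
  density_le y hy := h.density_le y (hts hy)
  le_density y hy := h.le_density y (hts hy)

lemma injOn (h : IsAlmostSimilarityOn f ρ K c s) : Set.InjOn f s := by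
  intro y hy z hz hyz
  have := h.ge y hy z hz
  simpa [hyz] using this

variable [MeasurableSpace X] [BorelSpace X] [MeasurableSpace Y] [BorelSpace Y]

/-- One factor `K` is the error of the Lipschitz constant, the other the error of replacing `c` by
`ρ`. -/
lemma hausdorffMeasure_image_le (h : IsAlmostSimilarityOn f ρ K c s) (hs : MeasurableSet s) :
    μH[1] (f '' s) ≤ (K : ℝ≥0∞) ^ 2 * ∫⁻ x in s, ρ x ∂μH[1] := by
  have h1 : μH[1] (f '' s) ≤ ↑(K * c) * μH[1] s := by
    have : LipschitzOnWith (K * c) f s := fun y hy z hz => h.le y hy z hz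
    simpa using this.hausdorffMeasure_image_le (d := 1) zero_le_one
  have h2 : (c : ℝ≥0∞) * μH[1] s ≤ K * ∫⁻ x in s, ρ x ∂μH[1] := by
    rw [← lintegral_const_mul' _ _ ENNReal.coe_ne_top, ← setLIntegral_const]
    exact setLIntegral_mono' hs fun x hx => by exact_mod_cast h.le_density x hx
  calc μH[1] (f '' s) ≤ ↑(K * c) * μH[1] s := h1
    _ = K * (c * μH[1] s) := by push_cast; ring
    _ ≤ K * (K * ∫⁻ x in s, ρ x ∂μH[1]) := by gcongr
    _ = _ := by ring

lemma le_hausdorffMeasure_image (h : IsAlmostSimilarityOn f ρ K c s) (hs : MeasurableSet s) :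
    ∫⁻ x in s, ρ x ∂μH[1] ≤ (K : ℝ≥0∞) ^ 2 * μH[1] (f '' s) := by
  have h1 : ∫⁻ x in s, ρ x ∂μH[1] ≤ ↑(K * c) * μH[1] s := by
    rw [← setLIntegral_const]
    exact setLIntegral_mono' hs fun x hx => by exact_mod_cast h.density_le x hx
  have h2 : μH[1] s ≤ ↑(K / c) * μH[1] (f '' s) := by
    rcases s.eq_empty_or_nonempty with rfl | ⟨x₀, -⟩
    · simp
    have : Nonempty X := ⟨x₀⟩
    -- The reverse bound is the Lipschitz estimate for the inverse map.
    have hL : LipschitzOnWith (K / c) (Function.invFunOn f s) (f '' s) := by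
      rintro _ ⟨y, hy, rfl⟩ _ ⟨z, hz, rfl⟩
      rw [h.injOn.leftInvOn_invFunOn hy, h.injOn.leftInvOn_invFunOn hz]
      exact h.ge y hy z hz
    have := hL.hausdorffMeasure_image_le (d := 1) zero_le_one
    rwa [h.injOn.invFunOn_image subset_rfl, ENNReal.rpow_one] at this
  have hc := h.ne_zero
  calc ∫⁻ x in s, ρ x ∂μH[1] ≤ ↑(K * c) * μH[1] s := h1
    _ ≤ ↑(K * c) * (↑(K / c) * μH[1] (f '' s)) := by gcongr
    _ = ↑(K * c * (K / c)) * μH[1] (f '' s) := by push_cast; ring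
    _ = _ := by
      rw [show K * c * (K / c) = K ^ 2 by field_simp]
      push_cast; rfl

end IsAlmostSimilarityOn

variable {f : X → Y} {ρ : X → ℝ≥0} {A : Set X}

lemma HasScalingAt.exists_nhds {x : X} (h : HasScalingAt f (ρ x) x) (hρ : ContinuousAt ρ x)
    (hx : ρ x ≠ 0) {K : ℝ≥0} (hK : 1 < K) :
    ∃ U, IsOpen U ∧ x ∈ U ∧ IsAlmostSimilarityOn f ρ K (ρ x) U := by
  obtain ⟨U, hU, hUf⟩ := h K hK
  have hpos : 0 < ρ x := pos_iff_ne_zero.2 hx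
  have h1 : ∀ᶠ y in 𝓝 x, ρ y < K * ρ x :=
    hρ.eventually_lt continuousAt_const (lt_mul_of_one_lt_left hpos hK)
  have h2 : ∀ᶠ y in 𝓝 x, ρ x < K * ρ y :=
    continuousAt_const.eventually_lt (continuousAt_const.mul hρ) (lt_mul_of_one_lt_left hpos hK)
  obtain ⟨W, hW, hWo, hxW⟩ := mem_nhds_iff.1 (Filter.inter_mem hU (h1.and h2))
  exact ⟨W, hWo, hxW, hx, fun y hy z hz => (hUf y (hW hy).1 z (hW hz).1).1,
    fun y hy z hz => (hUf y (hW hy).1 z (hW hz).1).2, fun y hy => (hW hy).2.1.le,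
    fun y hy => (hW hy).2.2.le⟩

/-- By the Lindelöf property countably many of the good neighbourhoods cover `A`; they are then made
disjoint. -/
lemma exists_partition_isAlmostSimilarityOn [MeasurableSpace X] [BorelSpace X]
    [SecondCountableTopology X]
    (hA : MeasurableSet A) (hρ : Continuous ρ)
    (hρA : ∀ x ∈ A, ρ x ≠ 0) (hf : ∀ x ∈ A, HasScalingAt f (ρ x) x) {K : ℝ≥0} (hK : 1 < K) :
    ∃ s : ℕ → Set X, (∀ i, MeasurableSet (s i)) ∧ Pairwise (Function.onFun Disjoint s) ∧
      ⋃ i, s i = A ∧ ∀ i, ∃ c, IsAlmostSimilarityOn f ρ K c (s i) := by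
  rcases A.eq_empty_or_nonempty with rfl | hne
  · exact ⟨fun _ => ∅, by simp, fun _ _ _ => by simp [Function.onFun], by simp,
      fun _ => ⟨1, one_ne_zero, by simp, by simp, by simp, by simp⟩⟩
  choose! U hUo hxU hU using fun x hx => (hf x hx).exists_nhds hρ.continuousAt (hρA x hx) hK
  obtain ⟨t, htA, htc, hAt⟩ := TopologicalSpace.countable_cover_nhdsWithin
    (fun x hx => mem_nhdsWithin_of_mem_nhds ((hUo x hx).mem_nhds (hxU x hx)))
  have htne : t.Nonempty := by
    obtain ⟨x, hx⟩ := hne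
    obtain ⟨y, hy, -⟩ := Set.mem_iUnion₂.1 (hAt hx)
    exact ⟨y, hy⟩
  obtain ⟨e, rfl⟩ := htc.exists_eq_range htne
  have he : ∀ i, e i ∈ A := fun i => htA ⟨i, rfl⟩
  refine ⟨disjointed fun i => A ∩ U (e i), fun i => ?_, disjoint_disjointed _, ?_, fun i => ?_⟩
  · exact MeasurableSet.disjointed (fun i => hA.inter (hUo _ (he i)).measurableSet) i
  · rw [iUnion_disjointed, ← Set.inter_iUnion, Set.inter_eq_left]
    simpa using hAt
  · exact ⟨_, (hU _ (he i)).mono ((disjointed_subset _ i).trans Set.inter_subset_right)⟩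

variable [MeasurableSpace X] [BorelSpace X] [MeasurableSpace Y] [BorelSpace Y]

/-- Each piece meets a fiber at most once, so counting a fiber is counting the images that contain
`y`. -/
lemma count_inter_fiber_eq_tsum (hfc : Continuous f) {K : ℝ≥0} {s : ℕ → Set X} (hs : ∀ i, MeasurableSet (s i))
    (hd : Pairwise (Function.onFun Disjoint s)) (hsA : ⋃ i, s i = A)
    (h : ∀ i, ∃ c, IsAlmostSimilarityOn f ρ K c (s i)) (y : Y) :
    Measure.count (A ∩ f ⁻¹' {y}) = ∑' i, (f '' s i).indicator (1 : Y → ℝ≥0∞) y := by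
  rw [← hsA, Set.iUnion_inter, measure_iUnion]
  · exact tsum_congr fun i => count_inter_fiber_of_injOn (h i).choose_spec.injOn y
  · exact fun i j hij => (hd hij).mono Set.inter_subset_left Set.inter_subset_left
  · exact fun i => (hs i).inter (hfc.measurable (measurableSet_singleton y))

variable [SecondCountableTopology X] [CompleteSpace X]

/-- Injective continuous images of Borel sets are Borel (Lusin–Souslin), which is where completeness
of `X` enters. Any `K > 1` would do. -/
lemma measurable_count_inter_fiber (hA : MeasurableSet A) (hfc : Continuous f) (hρ : Continuous ρ)
    (hρA : ∀ x ∈ A, ρ x ≠ 0) (hf : ∀ x ∈ A, HasScalingAt f (ρ x) x) :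
    Measurable fun y => Measure.count (A ∩ f ⁻¹' {y}) := by
  obtain ⟨s, hs, hd, hsA, h⟩ := exists_partition_isAlmostSimilarityOn hA hρ hρA hf one_lt_two
  simp_rw [count_inter_fiber_eq_tsum hfc hs hd hsA h]
  exact Measurable.tsum fun i => measurable_one.indicator
    ((hs i).image_of_continuousOn_injOn hfc.continuousOn (h i).choose_spec.injOn)

/-- The one-dimensional **area formula** for maps that are infinitesimal similarities. -/
theorem lintegral_count_inter_fiber (hA : MeasurableSet A) (hfc : Continuous f)
    (hρ : Continuous ρ) (hρA : ∀ x ∈ A, ρ x ≠ 0) (hf : ∀ x ∈ A, HasScalingAt f (ρ x) x) :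
    ∫⁻ y, Measure.count (A ∩ f ⁻¹' {y}) ∂μH[1] = ∫⁻ x in A, ρ x ∂μH[1] := by
  have key : ∀ K : ℝ≥0, 1 < K →
      ∫⁻ y, Measure.count (A ∩ f ⁻¹' {y}) ∂μH[1] ≤ (K : ℝ≥0∞) ^ 2 * ∫⁻ x in A, ρ x ∂μH[1] ∧
      ∫⁻ x in A, ρ x ∂μH[1] ≤ (K : ℝ≥0∞) ^ 2 * ∫⁻ y, Measure.count (A ∩ f ⁻¹' {y}) ∂μH[1] := by
    intro K hK
    obtain ⟨s, hs, hd, hsA, h⟩ := exists_partition_isAlmostSimilarityOn hA hρ hρA hf hK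
    have hm : ∀ i, MeasurableSet (f '' s i) := fun i =>
      (hs i).image_of_continuousOn_injOn hfc.continuousOn (h i).choose_spec.injOn
    have h1 : ∫⁻ y, Measure.count (A ∩ f ⁻¹' {y}) ∂μH[1] = ∑' i, μH[1] (f '' s i) := by
      simp_rw [count_inter_fiber_eq_tsum hfc hs hd hsA h]
      rw [lintegral_tsum fun i => (measurable_one.indicator (hm i)).aemeasurable]
      exact tsum_congr fun i => lintegral_indicator_one (hm i)
    have h2 : ∫⁻ x in A, ρ x ∂μH[1] = ∑' i, ∫⁻ x in s i, ρ x ∂μH[1] := by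
      rw [← hsA, lintegral_iUnion hs hd]
    rw [h1, h2, ← ENNReal.tsum_mul_left, ← ENNReal.tsum_mul_left]
    exact ⟨ENNReal.tsum_le_tsum fun i => (h i).choose_spec.hausdorffMeasure_image_le (hs i),
      ENNReal.tsum_le_tsum fun i => (h i).choose_spec.le_hausdorffMeasure_image (hs i)⟩
  have lim : ∀ a b : ℝ≥0∞, (∀ K : ℝ≥0, 1 < K → a ≤ (K : ℝ≥0∞) ^ 2 * b) → a ≤ b := by
    intro a b hab
    have ht : Filter.Tendsto (fun K : ℝ≥0 => (K : ℝ≥0∞) ^ 2 * b) (𝓝[>] 1) (𝓝 b) := by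
      have h0 : Filter.Tendsto (fun K : ℝ≥0 => ((K ^ 2 : ℝ≥0) : ℝ≥0∞)) (𝓝[>] 1) (𝓝 1) := by
        have : Continuous fun K : ℝ≥0 => ((K ^ 2 : ℝ≥0) : ℝ≥0∞) :=
          ENNReal.continuous_coe.comp (continuous_id.pow 2)
        simpa using (this.tendsto 1).mono_left nhdsWithin_le_nhds
      simpa using ENNReal.Tendsto.mul_const h0 (Or.inl one_ne_zero)
    exact ge_of_tendsto ht (Filter.eventually_of_mem self_mem_nhdsWithin hab)
  exact le_antisymm (lim _ _ fun K hK => (key K hK).1) (lim _ _ fun K hK => (key K hK).2)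

lemma measurable_count_restrict_fiber (hA : MeasurableSet A) (hfc : Continuous f)
    (hρ : Continuous ρ) (hρA : ∀ x ∈ A, ρ x ≠ 0) (hf : ∀ x ∈ A, HasScalingAt f (ρ x) x) :
    Measurable fun y => (Measure.count : Measure X).restrict (A ∩ f ⁻¹' {y}) := by
  refine Measure.measurable_of_measurable_coe _ fun B hB => ?_
  simp_rw [Measure.restrict_apply hB, ← Set.inter_assoc]
  exact measurable_count_inter_fiber (hB.inter hA) hfc hρ (fun x hx => hρA x hx.2)
    fun x hx => hf x hx.2

/-- The **area formula** on the part of the domain that lies over a given set. -/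
theorem bind_count_restrict_fiber (hA : MeasurableSet A) (hfc : Continuous f)
    (hρ : Continuous ρ) (hρA : ∀ x ∈ A, ρ x ≠ 0) (hf : ∀ x ∈ A, HasScalingAt f (ρ x) x)
    {E : Set Y} (hE : MeasurableSet E) :
    (μH[1].restrict E).bind (fun y => Measure.count.restrict (A ∩ f ⁻¹' {y})) =
      (μH[1].restrict (A ∩ f ⁻¹' E)).withDensity fun x => ρ x := by
  ext B hB
  rw [Measure.bind_apply hB (measurable_count_restrict_fiber hA hfc hρ hρA hf).aemeasurable,
    withDensity_apply _ hB, Measure.restrict_restrict hB,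
    ← lintegral_count_inter_fiber (hB.inter (hA.inter (hfc.measurable hE))) hfc hρ
      (fun x hx => hρA x hx.2.1) (fun x hx => hf x hx.2.1), ← lintegral_indicator hE]
  refine lintegral_congr fun y => ?_
  by_cases hy : y ∈ E
  · rw [Set.indicator_of_mem hy, Measure.restrict_apply hB]
    congr 1
    ext x
    simp only [Set.mem_inter_iff, Set.mem_preimage, Set.mem_singleton_iff]
    constructor
    · rintro ⟨h1, h2, h3⟩; exact ⟨⟨h1, h2, h3 ▸ hy⟩, h3⟩
    · rintro ⟨⟨h1, h2, -⟩, h3⟩; exact ⟨h1, h2, h3⟩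
  · rw [Set.indicator_of_notMem hy, eq_comm]
    convert measure_empty (μ := (Measure.count : Measure X))
    refine Set.eq_empty_of_forall_notMem fun x hx => hy ?_
    have h1 : f x = y := hx.2
    exact h1 ▸ hx.1.2.2

/-- The **area formula** integrated against a function on the domain. -/
theorem lintegral_lintegral_count_fiber (hA : MeasurableSet A) (hfc : Continuous f)
    (hρ : Continuous ρ) (hρA : ∀ x ∈ A, ρ x ≠ 0) (hf : ∀ x ∈ A, HasScalingAt f (ρ x) x)
    {E : Set Y} (hE : MeasurableSet E) {g : X → ℝ≥0∞} (hg : Measurable g) :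
    ∫⁻ y in E, ∫⁻ x in A ∩ f ⁻¹' {y}, g x ∂Measure.count ∂μH[1] =
      ∫⁻ x in A ∩ f ⁻¹' E, ρ x * g x ∂μH[1] := by
  rw [← Measure.lintegral_bind (measurable_count_restrict_fiber hA hfc hρ hρA hf).aemeasurable
    hg.aemeasurable, bind_count_restrict_fiber hA hfc hρ hρA hf hE,
    lintegral_withDensity_eq_lintegral_mul _ (by fun_prop) hg]
  rfl

/-- The **area formula** for injective maps. -/
theorem restrict_image_eq_map_withDensity (hA : MeasurableSet A) (hfc : Continuous f)
    (hρ : Continuous ρ) (hρA : ∀ x ∈ A, ρ x ≠ 0) (hf : ∀ x ∈ A, HasScalingAt f (ρ x) x)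
    (hinj : Set.InjOn f A) :
    μH[1].restrict (f '' A) = ((μH[1].restrict A).withDensity fun x => ρ x).map f := by
  ext B hB
  have hAB := hA.inter (hfc.measurable hB)
  have hi : Set.InjOn f (A ∩ f ⁻¹' B) := hinj.mono Set.inter_subset_left
  rw [Measure.restrict_apply hB, Measure.map_apply hfc.measurable hB,
    withDensity_apply _ (hfc.measurable hB), Measure.restrict_restrict (hfc.measurable hB),
    Set.inter_comm (f ⁻¹' B), ← lintegral_count_inter_fiber hAB hfc hρ
      (fun x hx => hρA x hx.1) (fun x hx => hf x hx.1)]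
  simp_rw [count_inter_fiber_of_injOn hi]
  rw [lintegral_indicator_one (hAB.image_of_continuousOn_injOn hfc.continuousOn hi),
    Set.image_inter_preimage, Set.inter_comm]

end AreaFormula

/-! ### Strict derivatives give infinitesimal similarities -/

section Deriv

variable {𝕜 F : Type*} [NontriviallyNormedField 𝕜] [NormedAddCommGroup F] [NormedSpace 𝕜 F]

lemma HasStrictDerivAt.hasScalingAt {f : 𝕜 → F} {f' : F} {x : 𝕜} (h : HasStrictDerivAt f f' x)
    (hf' : f' ≠ 0) : HasScalingAt f ‖f'‖₊ x := by
  intro K hK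
  have hc : 0 < ‖f'‖ := norm_pos_iff.2 hf'
  have hK' : (1 : ℝ) < K := by exact_mod_cast hK
  have hK0 : (0 : ℝ) < K := by linarith
  -- With this error the distortion lies between `1 / K` and `2 - 1 / K` times `‖f'‖`, and `2 - 1 /
  -- K ≤ K`.
  have hε : 0 < ‖f'‖ * (1 - 1 / K) :=
    mul_pos hc (sub_pos.2 ((div_lt_one hK0).2 hK'))
  have := h.isLittleO.def hε
  rw [nhds_prod_eq] at this
  obtain ⟨U, hU, hUf⟩ := Filter.eventually_prod_self_iff'.1 this
  refine ⟨U, hU, fun y hy z hz => ?_⟩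
  have hyz : ‖f y - f z - (y - z) • f'‖ ≤ ‖f'‖ * (1 - 1 / K) * ‖y - z‖ := by
    simpa using hUf y hy z hz
  have hs : ‖(y - z) • f'‖ = ‖y - z‖ * ‖f'‖ := norm_smul _ _
  have t1 := norm_sub_norm_le (f y - f z) ((y - z) • f')
  have t2 := norm_sub_norm_le ((y - z) • f') (f y - f z)
  rw [norm_sub_rev ((y - z) • f')] at t2
  have hn := norm_nonneg (y - z)
  have hKK : 2 - 1 / (K : ℝ) ≤ K := by
    rw [sub_le_iff_le_add, ← sub_nonneg]
    have : (K : ℝ) + 1 / K - 2 = (K - 1) ^ 2 / K := by field_simp; ring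
    rw [this]; positivity
  constructor
  · rw [edist_nndist, edist_nndist]
    norm_cast
    rw [← NNReal.coe_le_coe]
    push_cast
    rw [dist_eq_norm, dist_eq_norm]
    calc ‖f y - f z‖ ≤ (2 - 1 / K) * (‖f'‖ * ‖y - z‖) := by linarith
      _ ≤ K * (‖f'‖ * ‖y - z‖) := by gcongr
      _ = _ := by ring
  · rw [edist_nndist, edist_nndist]
    norm_cast
    rw [← NNReal.coe_le_coe]
    push_cast
    rw [dist_eq_norm, dist_eq_norm, div_mul_eq_mul_div, le_div_iff₀ hc]
    have : ‖f'‖ * ‖y - z‖ / K ≤ ‖f y - f z‖ := by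
      have : ‖f'‖ * ‖y - z‖ / K = ‖f'‖ * ‖y - z‖ - ‖f'‖ * (1 - 1 / K) * ‖y - z‖ := by ring
      linarith
    rw [div_le_iff₀ hK0] at this
    linarith

end Deriv

/-! ### Arc length on the circle -/

section Circle

lemma injOn_circleMap_Ioc {r : ℝ} (hr : r ≠ 0) :
    Set.InjOn (circleMap 0 r) (Set.Ioc 0 (2 * Real.pi)) := by
  have := injOn_circleMap_of_abs_sub_le (c := 0) (a := 0) (b := 2 * Real.pi) hr
    (by simp [abs_of_pos Real.pi_pos])
  rwa [Set.uIoc_of_le Real.two_pi_pos.le] at this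

/-- Arc length on a circle is the image of the Lebesgue measure under the angular
parametrisation. -/
lemma setLIntegral_sphere_hausdorffMeasure {r : ℝ} (hr : 0 < r) {g : ℂ → ℝ≥0∞}
    (hg : Measurable g) :
    ∫⁻ w in Metric.sphere 0 r, g w ∂μH[1] =
      ENNReal.ofReal r * ∫⁻ θ in Set.Ioc 0 (2 * Real.pi), g (circleMap 0 r θ) := by
  have hc : Continuous (circleMap 0 r) := continuous_circleMap 0 r
  have hd : ∀ θ, HasScalingAt (circleMap 0 r) ‖circleMap 0 r θ * Complex.I‖₊ θ := fun θ => by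
    have : ContDiff ℝ 1 (circleMap 0 r) := contDiff_circleMap 0 r
    refine ((this.contDiffAt.hasStrictDerivAt (x := θ) one_ne_zero).congr_deriv
      (hasDerivAt_circleMap 0 r θ).deriv).hasScalingAt ?_
    simp [circleMap_eq_center_iff, hr.ne']
  have hn : ∀ θ, ‖circleMap 0 r θ * Complex.I‖₊ = r.toNNReal := fun θ => by
    ext; simp [hr.le, abs_of_pos hr]
  have h := restrict_image_eq_map_withDensity (A := Set.Ioc 0 (2 * Real.pi))
    (ρ := fun _ => r.toNNReal) measurableSet_Ioc hc continuous_const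
    (fun _ _ => by simpa using hr) (fun θ _ => hn θ ▸ hd θ)
    (injOn_circleMap_Ioc hr.ne')
  rw [image_circleMap_Ioc, abs_of_pos hr, hausdorffMeasure_real] at h
  rw [h, lintegral_map hg hc.measurable, withDensity_const, lintegral_smul_measure]
  rfl

lemma ae_circleMap_notMem_of_finite {r : ℝ} (hr : 0 < r) {s : Set ℂ} (hs : s.Finite) :
    ∀ᵐ θ ∂volume.restrict (Set.Ioc 0 (2 * Real.pi)), circleMap 0 r θ ∉ s := by
  rw [ae_restrict_iff' measurableSet_Ioc]
  have hf : (Set.Ioc 0 (2 * Real.pi) ∩ circleMap 0 r ⁻¹' s).Finite :=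
    Set.Finite.of_finite_image (hs.subset (by rintro _ ⟨θ, hθ, rfl⟩; exact hθ.2))
      ((injOn_circleMap_Ioc hr.ne').mono Set.inter_subset_left)
  refine measure_mono_null (fun θ hθ => ?_) (hf.measure_zero volume)
  simpa [and_assoc] using hθ

end Circle

/-! ### Fibers of a polynomial -/

namespace Polynomial

lemma natDegree_eq_card_roots_sub_C (V : ℂ[X]) (w : ℂ) :
    Multiset.card (V - C w).roots = V.natDegree := by
  rw [← (IsAlgClosed.splits _).natDegree_eq_card_roots, natDegree_sub_C]

lemma leadingCoeff_sub_C {V : ℂ[X]} (hV : 0 < V.natDegree) (w : ℂ) :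
    (V - C w).leadingCoeff = V.leadingCoeff := by
  rw [leadingCoeff, natDegree_sub_C, coeff_sub, coeff_C_of_ne_zero hV.ne', sub_zero, leadingCoeff]

lemma nodup_roots_sub_C {V : ℂ[X]} (hV : 0 < V.natDegree) {w : ℂ}
    (hw : ∀ z, V.eval z = w → V.derivative.eval z ≠ 0) : (V - C w).roots.Nodup := by
  have h0 : V - C w ≠ 0 := fun h => by
    have := natDegree_sub_C (p := V) (a := w)
    rw [h, natDegree_zero] at this
    omega
  refine Multiset.nodup_iff_count_le_one.2 fun z => ?_
  rw [count_roots]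
  by_contra! h
  rw [one_lt_rootMultiplicity_iff_isRoot h0] at h
  simp only [IsRoot, eval_sub, eval_C, derivative_sub, derivative_C, sub_zero] at h
  exact hw z (sub_eq_zero.1 h.1) h.2

/-- The product of the distances from a point to the solutions of `V = w`, on the logarithmic
scale. -/
lemma sum_log_norm_sub_roots_sub_C {V : ℂ[X]} (hV : 0 < V.natDegree) {a w : ℂ}
    (hw : V.eval a ≠ w) :
    ((V - C w).roots.map fun z => Real.log ‖z - a‖).sum =
      Real.log ‖w - V.eval a‖ - Real.log ‖V.leadingCoeff‖ := by
  have hlead : V.leadingCoeff ≠ 0 := leadingCoeff_ne_zero.2 (by rintro rfl; simp at hV)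
  have h := (IsAlgClosed.splits (V - C w)).eval_eq_prod_roots a
  rw [leadingCoeff_sub_C hV, eval_sub, eval_C] at h
  have hprod : ((V - C w).roots.map (a - ·)).prod ≠ 0 := fun h0 => by
    rw [h0, mul_zero, sub_eq_zero] at h
    exact hw h
  rw [norm_sub_rev, h, norm_mul, Real.log_mul (norm_ne_zero_iff.2 hlead)
    (norm_ne_zero_iff.2 hprod), add_sub_cancel_left]
  have key : ∀ s : Multiset ℂ, (s.map (a - ·)).prod ≠ 0 →
      (s.map fun z => Real.log ‖z - a‖).sum = Real.log ‖(s.map (a - ·)).prod‖ := by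
    intro s
    induction s using Multiset.induction with
    | empty => simp
    | cons z s ih =>
      intro hs
      simp only [Multiset.map_cons, Multiset.prod_cons, Multiset.sum_cons] at hs ⊢
      rw [norm_mul, Real.log_mul (norm_ne_zero_iff.2 (left_ne_zero_of_mul hs))
        (norm_ne_zero_iff.2 (right_ne_zero_of_mul hs)), ih (right_ne_zero_of_mul hs),
        norm_sub_rev]
  exact key _ hprod

end Polynomial

lemma setLIntegral_count_toFinset {m : Multiset ℂ} (hm : m.Nodup) (g : ℂ → ℝ≥0∞) :
    ∫⁻ z in {z | z ∈ m}, g z ∂Measure.count = (m.map g).sum := by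
  have : {z | z ∈ m} = (m.toFinset : Set ℂ) := by ext; simp
  rw [this, lintegral_finset]
  simp only [Measure.count_singleton, mul_one]
  rw [Finset.sum, Multiset.toFinset_val, hm.dedup]

/-! ### Disintegration of the equilibrium measure over the circle -/

namespace Lemniscate

variable {V : ℂ[X]} {r : ℝ}

lemma measurableSet_lemniscate (V : ℂ[X]) (r : ℝ) : MeasurableSet (lemniscate V r) :=
  (isClosed_singleton.preimage V.continuous.norm).measurableSet

lemma finite_critical_values (hV : 0 < V.natDegree) :
    ((fun z => V.eval z) '' {z | V.derivative.eval z = 0}).Finite := by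
  refine Set.Finite.image _ ?_
  have h0 : V.derivative ≠ 0 := fun h => hV.ne' (derivative_eq_zero.1 h)
  exact (V.derivative.roots.toFinset.finite_toSet).subset fun z hz => by
    simpa [mem_roots h0] using hz

/-- Integration against the equilibrium measure is the average over the circle of radius `r` of
the mean over the fibers of `V`. -/
theorem lintegral_equilibriumMeasure (hV : 0 < V.natDegree) (hr : 0 < r) {g : ℂ → ℝ≥0∞}
    (hg : Measurable g) :
    ∫⁻ z, g z ∂equilibriumMeasure V r =
      ENNReal.ofReal (1 / (2 * Real.pi * V.natDegree)) *
        ∫⁻ θ in Set.Ioc 0 (2 * Real.pi), ((V - C (circleMap 0 r θ)).roots.map g).sum := by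
  have hρ : Continuous fun z => ‖V.derivative.eval z‖₊ := V.derivative.continuous.nnnorm
  -- The area formula needs a nonzero scaling factor, so critical points are removed.
  set N : Set ℂ := {z | V.derivative.eval z ≠ 0}
  have hNm : MeasurableSet N :=
    (isOpen_ne.preimage V.derivative.continuous).measurableSet
  have hf : ∀ z ∈ N, HasScalingAt (fun z => V.eval z) ‖V.derivative.eval z‖₊ z :=
    fun z hz => (V.hasStrictDerivAt z).hasScalingAt hz
  have hρN : ∀ z ∈ N, ‖V.derivative.eval z‖₊ ≠ 0 := fun z hz => nnnorm_ne_zero_iff.2 hz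
  have hE : MeasurableSet (Metric.sphere (0 : ℂ) r) := Metric.isClosed_sphere.measurableSet
  have hpre : (fun z => V.eval z) ⁻¹' Metric.sphere (0 : ℂ) r = lemniscate V r := by
    ext z; simp [lemniscate]
  have hm : (0 : ℝ) < V.natDegree := by exact_mod_cast hV
  have area := lintegral_lintegral_count_fiber hNm V.continuous hρ hρN hf hE hg
  have hmeas : Measurable fun w => ∫⁻ z in N ∩ (fun z => V.eval z) ⁻¹' {w}, g z ∂Measure.count :=
    (Measure.measurable_lintegral hg).comp
      (measurable_count_restrict_fiber hNm V.continuous hρ hρN hf)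
  have hfib : ∀ᵐ θ ∂volume.restrict (Set.Ioc 0 (2 * Real.pi)),
      ∫⁻ z in N ∩ (fun z => V.eval z) ⁻¹' {circleMap 0 r θ}, g z ∂Measure.count =
        ((V - C (circleMap 0 r θ)).roots.map g).sum := by
    -- Off the critical values the roots are simple, so counting measure on the fiber agrees with
    -- the root multiset.
    filter_upwards [ae_circleMap_notMem_of_finite hr (finite_critical_values hV)] with θ hθ
    have hw : ∀ z, V.eval z = circleMap 0 r θ → V.derivative.eval z ≠ 0 :=
      fun z hz h => hθ ⟨z, h, hz⟩
    rw [← setLIntegral_count_toFinset (nodup_roots_sub_C hV hw)]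
    congr 2
    ext z
    have h1 : V - C (circleMap 0 r θ) ≠ 0 := fun h => by
      have := natDegree_sub_C (p := V) (a := circleMap 0 r θ)
      rw [h, natDegree_zero] at this
      omega
    simp only [Set.mem_inter_iff, Set.mem_preimage, Set.mem_singleton_iff, Set.mem_ofPred_eq,
      mem_roots h1, IsRoot, eval_sub, eval_C, sub_eq_zero]
    exact ⟨fun h => h.2, fun h => ⟨hw z h, h⟩⟩
  rw [setLIntegral_sphere_hausdorffMeasure hr hmeas, lintegral_congr_ae hfib, hpre] at area
  have hdens : ∀ z, ENNReal.ofReal (‖V.derivative.eval z‖ / (2 * Real.pi * V.natDegree * r)) =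
      ENNReal.ofReal (1 / (2 * Real.pi * V.natDegree * r)) * ‖V.derivative.eval z‖₊ := fun z => by
    rw [← ENNReal.ofReal_coe_nnreal, coe_nnnorm, ← ENNReal.ofReal_mul (by positivity)]
    congr 1; ring
  rw [equilibriumMeasure, lintegral_withDensity_eq_lintegral_mul _ (by fun_prop) hg]
  simp_rw [Pi.mul_apply, hdens, mul_assoc]
  rw [lintegral_const_mul' _ _ ENNReal.ofReal_ne_top]
  -- Restoring the critical points costs nothing: the density `|V'|` vanishes there.
  have hoff : ∫⁻ z in lemniscate V r, ‖V.derivative.eval z‖₊ * g z ∂μH[1] =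
      ∫⁻ z in N ∩ lemniscate V r, ‖V.derivative.eval z‖₊ * g z ∂μH[1] := by
    rw [← Measure.restrict_restrict hNm, ← lintegral_indicator hNm]
    refine lintegral_congr fun z => ?_
    by_cases hz : z ∈ N
    · rw [Set.indicator_of_mem hz]
    · have : V.derivative.eval z = 0 := not_not.1 hz
      rw [Set.indicator_of_notMem hz, this]
      simp
  rw [hoff, ← area, ← mul_assoc, ← ENNReal.ofReal_mul (by positivity)]
  congr 2
  field_simp

end Lemniscate

/-! ### Logarithmic potential of the equilibrium measure -/

namespace Lemniscate

variable {V : ℂ[X]} {r : ℝ}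

lemma ae_mem_lemniscate (V : ℂ[X]) (r : ℝ) :
    ∀ᵐ z ∂equilibriumMeasure V r, z ∈ lemniscate V r :=
  (withDensity_absolutelyContinuous _ _).ae_le (ae_restrict_mem (measurableSet_lemniscate V r))

lemma ae_ne_equilibriumMeasure (V : ℂ[X]) (r : ℝ) (a : ℂ) :
    ∀ᵐ z ∂equilibriumMeasure V r, z ≠ a := by
  have := Measure.nullSingletonClass_hausdorff ℂ one_pos
  exact (withDensity_absolutelyContinuous _ _).ae_le
    (ae_restrict_of_ae (measure_eq_zero_iff_ae_notMem.1 (measure_singleton a)))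

lemma isBounded_lemniscate (hV : 0 < V.natDegree) (r : ℝ) :
    Bornology.IsBounded (lemniscate V r) := by
  have h := V.tendsto_norm_atTop (natDegree_pos_iff_degree_pos.1 hV)
    (tendsto_norm_cobounded_atTop (E := ℂ))
  rw [Bornology.isBounded_def]
  filter_upwards [h.eventually_gt_atTop r] with z hz hz'
  exact hz.ne' hz'

lemma isProbabilityMeasure_equilibriumMeasure (hV : 0 < V.natDegree) (hr : 0 < r) :
    IsProbabilityMeasure (equilibriumMeasure V r) := by
  have hm : (0 : ℝ) < V.natDegree := by exact_mod_cast hV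
  constructor
  have h := lintegral_equilibriumMeasure hV hr (measurable_const (a := (1 : ℝ≥0∞)))
  simp only [lintegral_one, Multiset.map_const', Multiset.sum_replicate, nsmul_eq_mul, mul_one,
    natDegree_eq_card_roots_sub_C, lintegral_const, Measure.restrict_apply_univ,
    Real.volume_Ioc, sub_zero] at h
  rw [h, ← ENNReal.ofReal_natCast, ← ENNReal.ofReal_mul (by positivity),
    ← ENNReal.ofReal_mul (by positivity), ENNReal.ofReal_eq_one]
  field_simp

lemma circleAverage_log_norm_sub {r : ℝ} (hr : 0 < r) (b : ℂ) :
    Real.circleAverage (fun w => Real.log ‖w - b‖) 0 r = Real.log (max r ‖b‖) := by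
  rw [circleAverage_log_norm_sub_const_eq_log_radius_add_posLog hr.ne',
    Real.posLog_eq_log_max_one (by positivity), ← Real.log_mul hr.ne' (by positivity),
    mul_max_of_nonneg _ _ hr.le]
  simp [hr.ne']

lemma _root_.Multiset.sum_map_ennreal_ofReal {α : Type*} (s : Multiset α) {h : α → ℝ}
    (hs : ∀ x ∈ s, 0 ≤ h x) :
    (s.map fun x => ENNReal.ofReal (h x)).sum = ENNReal.ofReal (s.map h).sum ∧
      0 ≤ (s.map h).sum := by
  induction s using Multiset.induction with
  | empty => simp
  | cons x s ih =>
    obtain ⟨h1, h2⟩ := ih fun y hy => hs y (Multiset.mem_cons_of_mem hy)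
    have hx := hs x (Multiset.mem_cons_self x s)
    simp only [Multiset.map_cons, Multiset.sum_cons]
    rw [h1, ENNReal.ofReal_add hx h2]
    exact ⟨rfl, add_nonneg hx h2⟩

/-- The logarithmic potential of the equilibrium measure. -/
theorem integrable_and_integral_log_norm_sub (hV : 0 < V.natDegree) (hr : 0 < r) (a : ℂ) :
    Integrable (fun z => Real.log ‖z - a‖) (equilibriumMeasure V r) ∧
    ∫ z, Real.log ‖z - a‖ ∂equilibriumMeasure V r =
      (Real.log (max r ‖V.eval a‖) - Real.log ‖V.leadingCoeff‖) / V.natDegree := by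
  have := isProbabilityMeasure_equilibriumMeasure hV hr
  have hm : (0 : ℝ) < V.natDegree := by exact_mod_cast hV
  obtain ⟨M, hM⟩ := (isBounded_lemniscate hV r).subset_closedBall a
  -- An upper bound for `log |z - a|` on the bounded set `L`: it makes `B - log |z - a|`
  -- nonnegative, so the identity for lower integrals yields integrability and the value together.
  set B := Real.log (max 1 M)
  set μ := equilibriumMeasure V r
  have hlog : ∀ z ∈ lemniscate V r, 0 ≤ B - Real.log ‖z - a‖ := fun z hz => by
    rw [sub_nonneg]
    rcases (norm_nonneg (z - a)).eq_or_lt with h | h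
    -- At `z = a` the convention `log 0 = 0` applies, and `B ≥ 0` is what is needed; hence the `1`
    -- in the maximum.
    · rw [← h, Real.log_zero]
      exact Real.log_nonneg (le_max_left _ _)
    · refine Real.log_le_log h (le_max_of_le_right ?_)
      simpa [dist_eq_norm] using hM hz
  have hmeas : Measurable fun z => B - Real.log ‖z - a‖ := by fun_prop
  have hae : 0 ≤ᵐ[μ] fun z => B - Real.log ‖z - a‖ :=
    (ae_mem_lemniscate V r).mono hlog
  set G : ℝ → ℝ := fun θ => V.natDegree * B + Real.log ‖V.leadingCoeff‖ -
    Real.log ‖circleMap 0 r θ - V.eval a‖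
  have hsum : ∀ᵐ θ ∂volume.restrict (Set.Ioc 0 (2 * Real.pi)),
      ((V - C (circleMap 0 r θ)).roots.map fun z => ENNReal.ofReal (B - Real.log ‖z - a‖)).sum =
        ENNReal.ofReal (G θ) ∧ 0 ≤ G θ := by
    -- If `w = V(a)`, then `a` is in the fiber and the sum of logarithms breaks down; this is a null
    -- set of angles.
    filter_upwards [ae_circleMap_notMem_of_finite hr (Set.finite_singleton (V.eval a))] with θ hθ
    have hroots : ∀ z ∈ (V - C (circleMap 0 r θ)).roots, 0 ≤ B - Real.log ‖z - a‖ := by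
      intro z hz
      have h := isRoot_of_mem_roots hz
      rw [IsRoot, eval_sub, eval_C, sub_eq_zero] at h
      exact hlog z (by simp [lemniscate, h, abs_of_pos hr])
    have h := Multiset.sum_map_ennreal_ofReal _ hroots
    rwa [Multiset.sum_map_sub, Multiset.map_const', Multiset.sum_replicate,
      natDegree_eq_card_roots_sub_C, sum_log_norm_sub_roots_sub_C hV (Ne.symm hθ),
      nsmul_eq_mul, ← sub_add, sub_add_eq_add_sub] at h
  have hci : IntegrableOn (fun θ => Real.log ‖circleMap 0 r θ - V.eval a‖)
      (Set.Ioc 0 (2 * Real.pi)) :=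
    (intervalIntegrable_iff_integrableOn_Ioc_of_le Real.two_pi_pos.le).1
      (circleIntegrable_log_norm_sub_const (c := 0) (a := V.eval a) r)
  have hGi : IntegrableOn G (Set.Ioc 0 (2 * Real.pi)) :=
    Integrable.sub (integrable_const _) hci
  have hGint : ∫ θ in Set.Ioc 0 (2 * Real.pi), G θ =
      2 * Real.pi * (V.natDegree * B + Real.log ‖V.leadingCoeff‖ -
        Real.log (max r ‖V.eval a‖)) := by
    have h := circleAverage_log_norm_sub hr (V.eval a)
    rw [Real.circleAverage_def, intervalIntegral.integral_of_le Real.two_pi_pos.le, smul_eq_mul,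
      inv_mul_eq_iff_eq_mul₀ Real.two_pi_pos.ne'] at h
    rw [integral_sub (integrable_const _) hci, h, integral_const]
    simp [Real.pi_pos.le]
    ring
  have hlint : ∫⁻ z, ENNReal.ofReal (B - Real.log ‖z - a‖) ∂μ =
      ENNReal.ofReal (1 / (2 * Real.pi * V.natDegree) *
        ∫ θ in Set.Ioc 0 (2 * Real.pi), G θ) := by
    rw [lintegral_equilibriumMeasure hV hr hmeas.ennreal_ofReal,
      lintegral_congr_ae (hsum.mono fun θ h => h.1),
      ← ofReal_integral_eq_lintegral_ofReal hGi (hsum.mono fun θ h => h.2),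
      ← ENNReal.ofReal_mul (by positivity)]
  have hnonneg : 0 ≤ ∫ θ in Set.Ioc 0 (2 * Real.pi), G θ :=
    integral_nonneg_of_ae (hsum.mono fun θ h => h.2)
  have hi : Integrable (fun z => B - Real.log ‖z - a‖) μ :=
    (lintegral_ofReal_ne_top_iff_integrable hmeas.aestronglyMeasurable hae).1
      (hlint ▸ ENNReal.ofReal_ne_top)
  have hint : ∫ z, (B - Real.log ‖z - a‖) ∂μ =
      1 / (2 * Real.pi * V.natDegree) * ∫ θ in Set.Ioc 0 (2 * Real.pi), G θ := by
    rw [integral_eq_lintegral_of_nonneg_ae hae hmeas.aestronglyMeasurable, hlint,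
      ENNReal.toReal_ofReal (by positivity)]
  have hi' : Integrable (fun z => Real.log ‖z - a‖) μ := by
    refine ((integrable_const B).sub hi).congr (ae_of_all _ fun z => ?_)
    simp
  refine ⟨hi', ?_⟩
  rw [integral_sub (integrable_const _) hi', hGint] at hint
  simp only [integral_const, probReal_univ, one_smul] at hint
  have h2 := Real.pi_pos
  rw [eq_div_iff hm.ne']
  field_simp at hint
  linarith

theorem integrable_and_integral_log_norm_eval (hV : 0 < V.natDegree) (hr : 0 < r) {ι : Type*}
    (s : Finset ι) {c : ℂ} (hc : c ≠ 0) (z : ι → ℂ) :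
    Integrable (fun t => Real.log ‖(C c * ∏ k ∈ s, (X - C (z k))).eval t‖)
      (equilibriumMeasure V r) ∧
    ∫ t, Real.log ‖(C c * ∏ k ∈ s, (X - C (z k))).eval t‖ ∂equilibriumMeasure V r =
      Real.log ‖c‖ + ∑ k ∈ s, (Real.log (max r ‖V.eval (z k)‖) -
        Real.log ‖V.leadingCoeff‖) / V.natDegree := by
  have := isProbabilityMeasure_equilibriumMeasure hV hr
  have hae : (fun t => Real.log ‖(C c * ∏ k ∈ s, (X - C (z k))).eval t‖) =ᵐ[equilibriumMeasure V r]
      fun t => Real.log ‖c‖ + ∑ k ∈ s, Real.log ‖t - z k‖ := by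
    -- The logarithm of the product splits only off the zeros, which are finitely many and carry no
    -- mass.
    have hne : ∀ᵐ t ∂equilibriumMeasure V r, ∀ k ∈ s, t ≠ z k :=
      (ae_ball_iff s.countable_toSet).2 fun k _ => ae_ne_equilibriumMeasure V r (z k)
    filter_upwards [hne] with t ht
    have ht' : ∀ k ∈ s, ‖t - z k‖ ≠ 0 := fun k hk =>
      norm_ne_zero_iff.2 (sub_ne_zero.2 (ht k hk))
    rw [eval_mul, eval_C, eval_prod, norm_mul, norm_prod]
    simp only [eval_sub, eval_X, eval_C]
    rw [Real.log_mul (norm_ne_zero_iff.2 hc) (Finset.prod_ne_zero_iff.2 ht'), Real.log_prod ht']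
  have hk := fun k => integrable_and_integral_log_norm_sub hV hr (z k)
  have hs := integrable_finsetSum s fun k _ => (hk k).1
  rw [integrable_congr hae, integral_congr_ae hae]
  refine ⟨(integrable_const _).add hs, ?_⟩
  rw [integral_add (integrable_const _) hs, integral_finsetSum s fun k _ => (hk k).1]
  simp [fun k => (hk k).2]

end Lemniscate

/-! ### Mahler measure formula and resultant bound -/

theorem proposition1 (V : ℂ[X]) (hV : 0 < V.natDegree) (r : ℝ) (hr : 0 < r)
    (n : ℕ) (c : ℂ) (hc : c ≠ 0) (z : Fin n → ℂ)
    (P : ℂ[X]) (hP : P = C c * ∏ k : Fin n, (X - C (z k))) :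
    IsProbabilityMeasure (Lemniscate.equilibriumMeasure V r) ∧
    Integrable (fun t : ℂ => Real.log ‖P.eval t‖) (Lemniscate.equilibriumMeasure V r) ∧
    Lemniscate.mahlerMeasure V r P =
      ‖c‖ * ‖V.leadingCoeff‖ ^ (-(n : ℝ) / (V.natDegree : ℝ)) *
        (∏ k : Fin n, max r ‖V.eval (z k)‖) ^ (1 / (V.natDegree : ℝ)) ∧
    Lemniscate.mahlerMeasure V r P ≥
      ‖V.leadingCoeff‖ ^ (-(n : ℝ) / (V.natDegree : ℝ)) *
        ‖Polynomial.resultant P V‖ ^ (1 / (V.natDegree : ℝ)) := by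
  subst hP
  obtain ⟨hi, hint⟩ := Lemniscate.integrable_and_integral_log_norm_eval hV hr Finset.univ hc z
  have hlead : 0 < ‖V.leadingCoeff‖ :=
    norm_pos_iff.2 (leadingCoeff_ne_zero.2 (by rintro rfl; simp at hV))
  have hmax : ∀ k, 0 < max r ‖V.eval (z k)‖ := fun k => lt_max_of_lt_left hr
  have heq : Lemniscate.mahlerMeasure V r (C c * ∏ k : Fin n, (X - C (z k))) =
      ‖c‖ * ‖V.leadingCoeff‖ ^ (-(n : ℝ) / (V.natDegree : ℝ)) *
        (∏ k : Fin n, max r ‖V.eval (z k)‖) ^ (1 / (V.natDegree : ℝ)) := by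
    rw [Lemniscate.mahlerMeasure, Lemniscate.geometricMean, hint, Real.exp_add,
      Real.exp_log (norm_pos_iff.2 hc), Real.rpow_def_of_pos hlead,
      Real.rpow_def_of_pos (Finset.prod_pos fun k _ => hmax k), mul_assoc, ← Real.exp_add,
      Real.log_prod fun k _ => (hmax k).ne', ← Finset.sum_div, Finset.sum_sub_distrib]
    congr 2
    simp
    ring
  refine ⟨Lemniscate.isProbabilityMeasure_equilibriumMeasure hV hr, hi, heq, ?_⟩
  have hres : ‖Polynomial.resultant (C c * ∏ k : Fin n, (X - C (z k))) V‖ =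
      ‖c‖ ^ V.natDegree * ∏ k : Fin n, ‖V.eval (z k)‖ := by
    have hmonic : (∏ k : Fin n, (X - C (z k))).Monic := monic_prod_X_sub_C _ _
    have hroots : (∏ k : Fin n, (X - C (z k))).roots = Finset.univ.val.map z := by
      rw [← roots_multiset_prod_X_sub_C (Finset.univ.val.map z), Multiset.map_map]
      rfl
    rw [resultant_eq_prod_eval _ _ _ le_rfl (IsAlgClosed.splits _), roots_C_mul _ hc,
      hroots, leadingCoeff_mul, leadingCoeff_C, hmonic.leadingCoeff, mul_one,
      norm_mul, norm_pow, ← norm_prod, Multiset.map_map]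
    rfl
  rw [heq, hres, ge_iff_le, Real.mul_rpow (by positivity) (by positivity), one_div,
    Real.pow_rpow_inv_natCast (norm_nonneg c) hV.ne', ← mul_assoc,
    mul_comm _ ‖c‖]
  gcongr
  exact le_max_right _ _
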